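/- Let $\alpha<\beta$, $\lambda>0$, and let $K:[0,\infty)\to[0,\infty)$ satisfy: (K1) $K$ is lower semicontinuous and non-decreasing with $K(0)=0$; (K2) for every $M>0$ there is a constant $C_M>0$ such that $K(\rho_1)+K(\rho_2)\ge K(\rho_1+\rho_2)+C_M\rho_1\rho_2$ for all $\rho_1,\rho_2\ge 0$ with $\rho_1+\rho_2\le M$; (K3) $\lim_{\rho\downarrow 0}K(\rho)/\rho=1$. For $u\in BV(\alpha,\beta)$ with distributional derivative $Du$, approximate jump set $J_u\subset(\alpha,\beta)$ and one-sided traces $u^\pm$, put $$TV_K(u)=|Du|\big((\alpha,\beta)\setminus J_u\big)+\sum_{x\in J_u}K\big(|u^+(x)-u^-(x)|\big),\qquad TV_{Kg}(u)=TV_K(u)+\frac{\lambda}{2}\int_\alpha^\beta|u-g|^2\,dx .$$ Let $g\in C[\alpha,\beta]$ be non-decreasing, $\rho=g(\beta)-g(\alpha)$, let $M>0$ with $\rho\le M$, let $C_M$ be a constant as in (K2) for this $M$, and assume $C_*:=C_M-\lambda(\beta-\alpha)/2>0$. Let $U_0$ be a minimizer of $TV_{Kg}$ among the piecewise constant functions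 $U$ on $[\alpha,\beta]$ with one jump, i.e. those for which there is $\gamma\in(\alpha,\beta)$ with $U=g(\alpha)$ on $[\alpha,\gamma)$ and $U=g(\beta)$ on $(\gamma,\beta]$ (a degenerate jump if $\rho=0$). Let $v$ be a non-decreasing function on $[\alpha,\beta]$ that is continuous at $\alpha$ and $\beta$, with $v(\alpha)=g(\alpha)$ and $v(\beta)=g(\beta)$. Let $J_v=\{z_i\}\subset(\alpha,\beta)$ be its (finite or countable, possibly empty) set of jump discontinuities and $\rho_i=v(z_i+0)-v(z_i-0)>0$. Then $\sum_i\rho_i$ and $\sum_i\rho_i^2$ converge, $$TV_{Kg}(v)\ \ge\ TV_{Kg}(U_0)+\frac{C_*}{2}\left(\Big(\sum_i\rho_i\Big)^2-\sum_i\rho_i^2+\Big(\rho-\sum_i\rho_i\Big)^2\right),$$ and the term in the large parentheses is non-negative. If $\rho>0$, that term vanishes if and only if $\rho=\rho_{i_0}$ for some $i_0$, i.e. $v$ has a jump of full size $\rho$. -/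

import Mathlib

open MeasureTheory Set Filter Topology
open scoped NNReal ENNReal ContDiff

noncomputable section

/-- (K1): `K : [0,∞) → [0,∞)` is lower semicontinuous, non-decreasing, and `K 0 = 0`. -/
structure CondK1 (K : ℝ≥0 → ℝ≥0) : Prop where
  lsc : LowerSemicontinuous K
  mono : Monotone K
  zero : K 0 = 0

/-- `C` is an admissible constant `C_M` in condition (K2) for the bound `M`. -/
structure IsK2Const (K : ℝ≥0 → ℝ≥0) (M C : ℝ) : Prop where
  pos : 0 < C
  ineq : ∀ ρ₁ ρ₂ : ℝ≥0, (ρ₁ : ℝ) + ρ₂ ≤ M →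
    (K (ρ₁ + ρ₂) : ℝ) + C * ρ₁ * ρ₂ ≤ K ρ₁ + K ρ₂

/-- (K2): for every `M > 0` there is an admissible constant. -/
def CondK2 (K : ℝ≥0 → ℝ≥0) : Prop :=
  ∀ M : ℝ, 0 < M → ∃ C : ℝ, IsK2Const K M C

/-- (K3): `K ρ / ρ → 1` as `ρ → 0`, `ρ > 0`. -/
def CondK3 (K : ℝ≥0 → ℝ≥0) : Prop :=
  Tendsto (fun ρ : ℝ≥0 => K ρ / ρ) (𝓝[>] 0) (𝓝 1)

/-- The finite signed Borel measure `μ` represents the distributional derivative of `u` in the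
open interval `(α, β)`. Only the restriction of `μ` to `(α, β)` is relevant, and that restriction
is uniquely determined by `u`. -/
def IsDistribDeriv (α β : ℝ) (u : ℝ → ℝ) (μ : SignedMeasure ℝ) : Prop :=
  ∀ φ : ℝ → ℝ, ContDiff ℝ ∞ φ → HasCompactSupport φ → tsupport φ ⊆ Ioo α β →
    ∫ x in Ioo α β, u x * deriv φ x = - μ.integral φ (ContinuousLinearMap.lsmul ℝ ℝ)

/-- `u ∈ BV(α, β)`. -/
def MemBV (α β : ℝ) (u : ℝ → ℝ) : Prop :=
  IntegrableOn u (Ioo α β) ∧ ∃ μ : SignedMeasure ℝ, IsDistribDeriv α β u μ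

open Classical in
/-- The distributional derivative `Du` on `(α, β)` of a function of bounded variation. -/
def distribDeriv (α β : ℝ) (u : ℝ → ℝ) : SignedMeasure ℝ :=
  if h : ∃ μ : SignedMeasure ℝ, IsDistribDeriv α β u μ then h.choose else 0

/-- `a` is the approximate one-sided limit (trace) of `u` at `x` from the left. -/
def HasLeftTrace (u : ℝ → ℝ) (x a : ℝ) : Prop :=
  Tendsto (fun r : ℝ => (∫⁻ y in Ioo (x - r) x, ‖u y - a‖ₑ) / ENNReal.ofReal r) (𝓝[>] 0) (𝓝 0)

/-- `a` is the approximate one-sided limit (trace) of `u` at `x` from the right. -/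
def HasRightTrace (u : ℝ → ℝ) (x a : ℝ) : Prop :=
  Tendsto (fun r : ℝ => (∫⁻ y in Ioo x (x + r), ‖u y - a‖ₑ) / ENNReal.ofReal r) (𝓝[>] 0) (𝓝 0)

/-- The approximate jump set of `u` in `(α, β)`. -/
def approxJumpSet (α β : ℝ) (u : ℝ → ℝ) : Set ℝ :=
  {x | x ∈ Ioo α β ∧ ∃ a b : ℝ, a ≠ b ∧ HasLeftTrace u x a ∧ HasRightTrace u x b}

/-- The trace of `u` at `x` from the left (unique where it exists). -/
def leftTrace (u : ℝ → ℝ) (x : ℝ) : ℝ := Classical.epsilon (HasLeftTrace u x)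

/-- The trace of `u` at `x` from the right (unique where it exists). -/
def rightTrace (u : ℝ → ℝ) (x : ℝ) : ℝ := Classical.epsilon (HasRightTrace u x)

open Classical in
/-- `TV_K(u) = |Du|((α,β) \ J_u) + ∑_{x ∈ J_u} K(|u⁺(x) - u⁻(x)|)` for `u ∈ BV(α, β)`, and `∞`
outside `BV(α, β)`. -/
def tvK (K : ℝ≥0 → ℝ≥0) (α β : ℝ) (u : ℝ → ℝ) : ℝ≥0∞ :=
  if MemBV α β u then
    (distribDeriv α β u).variation (Ioo α β \ approxJumpSet α β u)
      + ∑' x : approxJumpSet α β u, (K ‖rightTrace u x - leftTrace u x‖₊ : ℝ≥0∞)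
  else ∞

/-- The fidelity `(λ/2) ∫_{(α,β)} |u - g|²`. -/
def fidelity (lam α β : ℝ) (g u : ℝ → ℝ) : ℝ≥0∞ :=
  ENNReal.ofReal (lam / 2) * ∫⁻ x in Ioo α β, ‖u x - g x‖ₑ ^ 2

/-- The energy `TV_{Kg} = TV_K + fidelity` on `(α, β)`. -/
def tvKg (K : ℝ≥0 → ℝ≥0) (lam α β : ℝ) (g u : ℝ → ℝ) : ℝ≥0∞ :=
  tvK K α β u + fidelity lam α β g u

/-- Piecewise constant functions on `[α, β]` with one jump, at a point `γ ∈ (α, β)`, that agree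
with `g` at `α` and at `β` (the value at `γ` itself is immaterial; if `g α = g β` the jump
degenerates). -/
def IsOneJump (α β : ℝ) (g U : ℝ → ℝ) : Prop :=
  ∃ γ ∈ Ioo α β, (∀ x ∈ Ico α γ, U x = g α) ∧ (∀ x ∈ Ioc γ β, U x = g β)

/-- `U` minimizes `TV_{Kg}` among the one-jump functions. -/
def IsOptimalOneJump (K : ℝ≥0 → ℝ≥0) (lam α β : ℝ) (g U : ℝ → ℝ) : Prop :=
  IsOneJump α β g U ∧ ∀ W : ℝ → ℝ, IsOneJump α β g W → tvKg K lam α β g U ≤ tvKg K lam α β g W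

/-- `v(z+0) - v(z-0)`. -/
def jumpSize (v : ℝ → ℝ) (z : ℝ) : ℝ := Function.rightLim v z - Function.leftLim v z

/-- The jump discontinuities in `(α, β)` of a function having one-sided limits there. -/
def jumpPoints (α β : ℝ) (v : ℝ → ℝ) : Set ℝ :=
  {z | z ∈ Ioo α β ∧ Function.leftLim v z ≠ Function.rightLim v z}

/-- `(∑ ρ_i)² - ∑ ρ_i² + (ρ - ∑ ρ_i)²`, the sums running over the jumps `ρ_i` of `v`. -/
def jumpTerm (α β ρ : ℝ) (v : ℝ → ℝ) : ℝ :=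
  (∑' z : jumpPoints α β v, jumpSize v z) ^ 2 - ∑' z : jumpPoints α β v, jumpSize v z ^ 2
    + (ρ - ∑' z : jumpPoints α β v, jumpSize v z) ^ 2

end

theorem signedMeasure_integral_lsmul_eq (μ : SignedMeasure ℝ) (φ : ℝ → ℝ)
    (hp : Integrable φ μ.toJordanDecomposition.posPart)
    (hn : Integrable φ μ.toJordanDecomposition.negPart) :
    μ.integral φ (ContinuousLinearMap.lsmul ℝ ℝ) =
      ∫ x, φ x ∂μ.toJordanDecomposition.posPart - ∫ x, φ x ∂μ.toJordanDecomposition.negPart := by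
  have hflip : (ContinuousLinearMap.lsmul ℝ ℝ : ℝ →L[ℝ] ℝ →L[ℝ] ℝ)
      = (ContinuousLinearMap.lsmul ℝ ℝ).flip := by
    ext; simp
  conv_lhs => rw [← μ.toSignedMeasure_toJordanDecomposition, JordanDecomposition.toSignedMeasure,
    hflip]
  rw [VectorMeasure.integral_sub_vectorMeasure, VectorMeasure.integral_toSignedMeasure,
    VectorMeasure.integral_toSignedMeasure]
  · simpa [VectorMeasure.Integrable] using hp
  · simpa [VectorMeasure.Integrable] using hn

theorem toSignedMeasure_integral_lsmul_eq (μ : Measure ℝ) [IsFiniteMeasure μ] (φ : ℝ → ℝ) :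
    μ.toSignedMeasure.integral φ (ContinuousLinearMap.lsmul ℝ ℝ) = ∫ x, φ x ∂μ := by
  have hflip : (ContinuousLinearMap.lsmul ℝ ℝ : ℝ →L[ℝ] ℝ →L[ℝ] ℝ)
      = (ContinuousLinearMap.lsmul ℝ ℝ).flip := by
    ext; simp
  rw [hflip, VectorMeasure.integral_toSignedMeasure]

/-- A signed measure annihilating all test functions on an open set has no variation there. -/
theorem totalVariation_eq_zero_of_integral_eq_zero {U : Set ℝ} (hU : IsOpen U)
    (μ : SignedMeasure ℝ)
    (h : ∀ φ : ℝ → ℝ, ContDiff ℝ ∞ φ → HasCompactSupport φ → tsupport φ ⊆ U →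
      μ.integral φ (ContinuousLinearMap.lsmul ℝ ℝ) = 0) : μ.totalVariation U = 0 := by
  obtain ⟨S, hS, -, -, hpos, hneg⟩ := μ.toJordanDecomposition.exists_compl_positive_negative
  set p := μ.toJordanDecomposition.posPart
  set n := μ.toJordanDecomposition.negPart
  classical
  set f : ℝ → ℝ := fun x => if x ∈ S then -1 else 1 with hf
  have hfm : Measurable f := Measurable.ite hS measurable_const measurable_const
  have hfb : ∀ x, ‖f x‖ ≤ 1 := by intro x; simp only [hf]; split_ifs <;> simp
  have hint : Integrable f μ.totalVariation :=
    Integrable.of_bound hfm.aestronglyMeasurable 1 (Eventually.of_forall hfb)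
  have hfp : ∀ᵐ x ∂p, f x = 1 := by
    have : ∀ᵐ x ∂p, x ∉ S := measure_eq_zero_iff_ae_notMem.1 hpos
    filter_upwards [this] with x hx
    simp [hf, hx]
  have hfn : ∀ᵐ x ∂n, f x = -1 := by
    have : ∀ᵐ x ∂n, x ∉ Sᶜ := measure_eq_zero_iff_ae_notMem.1 hneg
    filter_upwards [this] with x hx
    simp only [mem_compl_iff, not_not] at hx
    simp [hf, hx]
  have key := hU.ae_eq_zero_of_integral_contDiff_smul_eq_zero
    (hint.locallyIntegrable.locallyIntegrableOn U) (fun φ hφ hφc hφU => by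
      have hbd : ∀ m : Measure ℝ, IsFiniteMeasure m → Integrable φ m := fun m _ =>
        hφ.continuous.integrable_of_hasCompactSupport hφc
      have hbd' : ∀ m : Measure ℝ, IsFiniteMeasure m → Integrable (fun x => φ x • f x) m :=
        fun m _ => by
          simpa only [smul_eq_mul, mul_comm] using
            (hbd m ‹_›).bdd_mul (c := 1) hfm.aestronglyMeasurable (Eventually.of_forall hfb)
      have h0 := h φ hφ hφc hφU
      rw [signedMeasure_integral_lsmul_eq μ φ (hbd _ inferInstance) (hbd _ inferInstance)] at h0
      rw [SignedMeasure.totalVariation, integral_add_measure (hbd' _ inferInstance)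
        (hbd' _ inferInstance)]
      have e1 : ∫ x, φ x • f x ∂p = ∫ x, φ x ∂p :=
        integral_congr_ae (by filter_upwards [hfp] with x hx; simp [hx])
      have e2 : ∫ x, φ x • f x ∂n = - ∫ x, φ x ∂n := by
        rw [← integral_neg]
        exact integral_congr_ae (by filter_upwards [hfn] with x hx; simp [hx])
      rw [e1, e2]
      linarith)
  rw [measure_eq_zero_iff_ae_notMem]
  filter_upwards [key] with x hx hxU
  have := hx hxU
  simp only [hf] at this
  split_ifs at this <;> norm_num at this

/-- The distributional derivative is unique on the interval. -/
theorem IsDistribDeriv.variation_eq {α β : ℝ} {u : ℝ → ℝ} {μ ν : SignedMeasure ℝ}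
    (hμ : IsDistribDeriv α β u μ) (hν : IsDistribDeriv α β u ν) {E : Set ℝ}
    (hE : MeasurableSet E) (hEI : E ⊆ Ioo α β) : μ.variation E = ν.variation E := by
  have hzero : (μ - ν).totalVariation (Ioo α β) = 0 := by
    apply totalVariation_eq_zero_of_integral_eq_zero isOpen_Ioo
    intro φ hφ hφc hφU
    have hb : ∀ m : SignedMeasure ℝ, m.Integrable φ := fun m => by
      rw [VectorMeasure.Integrable, ← SignedMeasure.totalVariation_eq_variation]
      exact hφ.continuous.integrable_of_hasCompactSupport hφc
    rw [VectorMeasure.integral_sub_vectorMeasure (hb μ) (hb ν)]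
    have h1 := hμ φ hφ hφc hφU
    have h2 := hν φ hφ hφc hφU
    linarith
  have hres : μ.restrict (Ioo α β) = ν.restrict (Ioo α β) := by
    ext A hA
    rw [VectorMeasure.restrict_apply _ measurableSet_Ioo hA,
      VectorMeasure.restrict_apply _ measurableSet_Ioo hA]
    have := (μ - ν).null_of_totalVariation_zero
      (measure_mono_null (inter_subset_right : A ∩ Ioo α β ⊆ Ioo α β) hzero)
    rw [_root_.sub_apply] at this
    linarith
  have h1 := congrArg (fun m : SignedMeasure ℝ => m.variation E) hres
  simpa [VectorMeasure.variation_restrict, Measure.restrict_apply hE,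
    inter_eq_self_of_subset_left hEI, measurableSet_Ioo] using h1

/-- Integration by parts: the Stieltjes measure of a monotone function is its distributional
derivative. -/
theorem Monotone.isDistribDeriv {F : ℝ → ℝ} (hF : Monotone F) {α β : ℝ} (hαβ : α < β)
    [IsFiniteMeasure (hF.stieltjesFunction.measure.restrict (Ioo α β))] :
    IsDistribDeriv α β F
      (hF.stieltjesFunction.measure.restrict (Ioo α β)).toSignedMeasure := by
  intro φ hφ hφc hφU
  rw [toSignedMeasure_integral_lsmul_eq]
  set s := hF.stieltjesFunction with hs
  set ν := s.measure.restrict (Ioo α β) with hν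
  have hφα : φ α = 0 := image_eq_zero_of_notMem_tsupport fun h => (hφU h).1.false
  have hφβ : φ β = 0 := image_eq_zero_of_notMem_tsupport fun h => (hφU h).2.false
  have hd : Continuous (deriv φ) := hφ.continuous_deriv (by simp)
  have hdiff : Differentiable ℝ φ := hφ.differentiable (by simp)
  have hdI : Integrable (deriv φ) (volume.restrict (Ioo α β)) :=
    (hd.integrableOn_Icc).mono_set Ioo_subset_Icc_self
  have ftc : ∀ a b, a ≤ b → ∫ x in Ioo a b, deriv φ x = φ b - φ a := fun a b hab => by
    rw [← integral_Ioc_eq_integral_Ioo, ← intervalIntegral.integral_of_le hab]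
    exact intervalIntegral.integral_deriv_eq_sub (fun x _ => hdiff x) (hd.intervalIntegrable _ _)
  -- the kernel of the representation of `F` by its Stieltjes measure
  let k : ℝ → ℝ → ℝ := fun x y => (Iic x).indicator (fun _ => deriv φ x) y
  have hkm : Measurable (Function.uncurry k) := by
    have : Function.uncurry k = {q : ℝ × ℝ | q.2 ≤ q.1}.indicator (fun q => deriv φ q.1) := by
      ext ⟨x, y⟩; simp [k, indicator, Function.uncurry]
    rw [this]
    exact (hd.measurable.comp measurable_fst).indicator (measurableSet_le measurable_snd measurable_fst)
  have hkI : Integrable (Function.uncurry k) ((volume.restrict (Ioo α β)).prod ν) := by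
    have h1 : Integrable (fun q : ℝ × ℝ => deriv φ q.1) ((volume.restrict (Ioo α β)).prod ν) :=
      hdI.comp_fst ν
    refine h1.mono hkm.aestronglyMeasurable (Eventually.of_forall ?_)
    rintro ⟨x, y⟩
    simp only [Function.uncurry, k, indicator]
    split_ifs <;> simp
  have hswap := integral_integral_swap hkI
  have hin : ∀ x ∈ Ioo α β, ∫ y, k x y ∂ν = (s x - s α) * deriv φ x := by
    intro x hx
    simp only [k]
    rw [integral_indicator_const _ measurableSet_Iic, smul_eq_mul, measureReal_def, hν,
      Measure.restrict_apply measurableSet_Iic,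
      show Iic x ∩ Ioo α β = Ioc α x by
        ext y; simp only [mem_inter_iff, mem_Iic, mem_Ioo, mem_Ioc]
        have := hx.2; constructor <;> intro h
        · exact ⟨h.2.1, h.1⟩
        · exact ⟨h.2, h.1, h.2.trans_lt this⟩,
      s.measure_Ioc, ENNReal.toReal_ofReal (sub_nonneg.2 (s.mono hx.1.le))]
  have hout : ∀ y ∈ Ioo α β, ∫ x in Ioo α β, k x y = - φ y := by
    intro y hy
    have : (fun x => k x y) = (Ici y).indicator (deriv φ) := by
      ext x; simp [k, indicator]
    rw [this, setIntegral_indicator measurableSet_Ici,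
      show Ioo α β ∩ Ici y = Ico y β by
        ext x; simp only [mem_inter_iff, mem_Ici, mem_Ioo, mem_Ico]
        have := hy.1; constructor <;> intro h
        · exact ⟨h.2, h.1.2⟩
        · exact ⟨⟨this.trans_le h.1, h.2⟩, h.1⟩,
      integral_Ico_eq_integral_Ioo, ftc y β hy.2.le, hφβ, zero_sub]
  have hsF : ∀ᵐ x : ℝ, F x = s x := by
    have : ∀ᵐ x : ℝ, x ∉ {x | ¬ ContinuousAt F x} :=
      hF.countable_not_continuousAt.ae_notMem _
    filter_upwards [this] with x hx
    exact ((not_not.1 hx).continuousWithinAt.rightLim_eq).symm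
  have e1 : ∫ x in Ioo α β, F x * deriv φ x
      = ∫ x in Ioo α β, ((∫ y, k x y ∂ν) + s α * deriv φ x) := by
    refine setIntegral_congr_ae measurableSet_Ioo ?_
    filter_upwards [hsF] with x hx hxI
    rw [hin x hxI, hx]; ring
  have hI : Integrable (fun x => ∫ y, k x y ∂ν) (volume.restrict (Ioo α β)) :=
    hkI.integral_prod_left
  rw [e1, integral_add hI (hdI.const_mul _), hswap, integral_const_mul,
    ftc α β hαβ.le, hφα, hφβ]
  have e2 : ∫ y, (∫ x in Ioo α β, k x y) ∂ν = ∫ y, - φ y ∂ν :=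
    setIntegral_congr_fun measurableSet_Ioo hout
  rw [e2, integral_neg]; ring

theorem isDistribDeriv_congr {α β : ℝ} {u w : ℝ → ℝ} (h : u =ᵐ[volume.restrict (Ioo α β)] w) :
    IsDistribDeriv α β u = IsDistribDeriv α β w := by
  ext μ
  unfold IsDistribDeriv
  have : ∀ φ : ℝ → ℝ, ∫ x in Ioo α β, u x * deriv φ x = ∫ x in Ioo α β, w x * deriv φ x :=
    fun φ => integral_congr_ae (by filter_upwards [h] with x hx; rw [hx])
  simp only [this]

theorem memBV_congr {α β : ℝ} {u w : ℝ → ℝ} (h : u =ᵐ[volume.restrict (Ioo α β)] w) :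
    MemBV α β u ↔ MemBV α β w := by
  unfold MemBV
  rw [isDistribDeriv_congr h, IntegrableOn, IntegrableOn, integrable_congr h]

theorem distribDeriv_congr {α β : ℝ} {u w : ℝ → ℝ} (h : u =ᵐ[volume.restrict (Ioo α β)] w) :
    distribDeriv α β u = distribDeriv α β w := by
  unfold distribDeriv
  rw [isDistribDeriv_congr h]

theorem hasLeftTrace_congr {α β : ℝ} {u w : ℝ → ℝ} (h : u =ᵐ[volume.restrict (Ioo α β)] w)
    {x : ℝ} (hx : x ∈ Ioo α β) : HasLeftTrace u x = HasLeftTrace w x := by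
  ext a
  refine tendsto_congr' ?_
  filter_upwards [Ioo_mem_nhdsGT (sub_pos.2 hx.1)] with r hr
  have hsub : Ioo (x - r) x ⊆ Ioo α β := Ioo_subset_Ioo (by linarith [hr.2]) hx.2.le
  rw [lintegral_congr_ae]
  filter_upwards [ae_restrict_of_ae_restrict_of_subset hsub h] with y hy
  rw [hy]

theorem hasRightTrace_congr {α β : ℝ} {u w : ℝ → ℝ} (h : u =ᵐ[volume.restrict (Ioo α β)] w)
    {x : ℝ} (hx : x ∈ Ioo α β) : HasRightTrace u x = HasRightTrace w x := by
  ext a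
  refine tendsto_congr' ?_
  filter_upwards [Ioo_mem_nhdsGT (sub_pos.2 hx.2)] with r hr
  have hsub : Ioo x (x + r) ⊆ Ioo α β := Ioo_subset_Ioo hx.1.le (by linarith [hr.2])
  rw [lintegral_congr_ae]
  filter_upwards [ae_restrict_of_ae_restrict_of_subset hsub h] with y hy
  rw [hy]

theorem approxJumpSet_congr {α β : ℝ} {u w : ℝ → ℝ} (h : u =ᵐ[volume.restrict (Ioo α β)] w) :
    approxJumpSet α β u = approxJumpSet α β w := by
  ext x
  refine and_congr_right fun hx => ?_
  rw [hasLeftTrace_congr h hx, hasRightTrace_congr h hx]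

theorem tvK_congr (K : ℝ≥0 → ℝ≥0) {α β : ℝ} {u w : ℝ → ℝ}
    (h : u =ᵐ[volume.restrict (Ioo α β)] w) : tvK K α β u = tvK K α β w := by
  by_cases hBV : MemBV α β u
  · rw [tvK, tvK, if_pos hBV, if_pos ((memBV_congr h).1 hBV), distribDeriv_congr h,
      approxJumpSet_congr h]
    congr 1
    refine tsum_congr fun x => ?_
    rw [rightTrace, rightTrace, leftTrace, leftTrace, hasLeftTrace_congr h x.2.1,
      hasRightTrace_congr h x.2.1]
  · rw [tvK, tvK, if_neg hBV, if_neg (mt (memBV_congr h).2 hBV)]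

theorem fidelity_congr {lam α β : ℝ} {g₁ g₂ u₁ u₂ : ℝ → ℝ}
    (hg : g₁ =ᵐ[volume.restrict (Ioo α β)] g₂) (hu : u₁ =ᵐ[volume.restrict (Ioo α β)] u₂) :
    fidelity lam α β g₁ u₁ = fidelity lam α β g₂ u₂ := by
  unfold fidelity
  congr 1
  refine lintegral_congr_ae ?_
  filter_upwards [hg, hu] with x h1 h2
  rw [h1, h2]

theorem tendsto_lintegral_div_of_tendsto {u : ℝ → ℝ} {a : ℝ} {l : Filter ℝ} {I : ℝ → Set ℝ}
    (hu : Tendsto u l (𝓝 a)) (hI : ∀ A ∈ l, ∀ᶠ r in 𝓝[>] (0 : ℝ), I r ⊆ A)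
    (hvol : ∀ r, volume (I r) = ENNReal.ofReal r) (hIm : ∀ r, MeasurableSet (I r)) :
    Tendsto (fun r : ℝ => (∫⁻ y in I r, ‖u y - a‖ₑ) / ENNReal.ofReal r) (𝓝[>] 0) (𝓝 0) := by
  rw [ENNReal.tendsto_nhds_zero]
  intro ε hε
  have h1 : Tendsto (fun y => ‖u y - a‖ₑ) l (𝓝 0) := by
    simpa using (hu.sub_const a).enorm
  filter_upwards [hI _ (ENNReal.tendsto_nhds_zero.1 h1 ε hε), self_mem_nhdsWithin] with r hr hr0
  refine ENNReal.div_le_of_le_mul ?_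
  calc ∫⁻ y in I r, ‖u y - a‖ₑ ≤ ∫⁻ _ in I r, ε :=
        setLIntegral_mono' (hIm r) fun y hy => hr hy
    _ = ε * ENNReal.ofReal r := by rw [setLIntegral_const, hvol]

theorem eq_of_tendsto_lintegral_div {u : ℝ → ℝ} (hu : Measurable u) {a b : ℝ} {I : ℝ → Set ℝ}
    (hvol : ∀ r, volume (I r) = ENNReal.ofReal r)
    (ha : Tendsto (fun r : ℝ => (∫⁻ y in I r, ‖u y - a‖ₑ) / ENNReal.ofReal r) (𝓝[>] 0) (𝓝 0))
    (hb : Tendsto (fun r : ℝ => (∫⁻ y in I r, ‖u y - b‖ₑ) / ENNReal.ofReal r) (𝓝[>] 0) (𝓝 0)) :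
    a = b := by
  have hsum := ha.add hb
  rw [add_zero] at hsum
  have hle : ‖a - b‖ₑ ≤ 0 := by
    refine ge_of_tendsto hsum ?_
    filter_upwards [self_mem_nhdsWithin] with r hr
    have hr' : (0 : ℝ) < r := hr
    rw [← ENNReal.add_div, ENNReal.le_div_iff_mul_le (by simp [hr']) (by simp),
      ← lintegral_add_left (hu.sub_const a).enorm, ← hvol, ← setLIntegral_const]
    refine lintegral_mono fun y => ?_
    calc ‖a - b‖ₑ = ‖(u y - b) - (u y - a)‖ₑ := by congr 1; ring
      _ ≤ ‖u y - b‖ₑ + ‖u y - a‖ₑ := enorm_sub_le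
      _ = _ := add_comm _ _
  have : ‖a - b‖ₑ = 0 := le_antisymm hle zero_le
  rwa [enorm_eq_zero, sub_eq_zero] at this

theorem hasLeftTrace_of_tendsto {u : ℝ → ℝ} {x a : ℝ} (hu : Tendsto u (𝓝[<] x) (𝓝 a)) :
    HasLeftTrace u x a := by
  refine tendsto_lintegral_div_of_tendsto hu (fun A hA => ?_) (by simp) fun _ => measurableSet_Ioo
  obtain ⟨l, hl, hlA⟩ := mem_nhdsLT_iff_exists_Ioo_subset.1 hA
  filter_upwards [Ioo_mem_nhdsGT (sub_pos.2 hl)] with r hr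
  exact (Ioo_subset_Ioo_left (by linarith [hr.2])).trans hlA

theorem hasRightTrace_of_tendsto {u : ℝ → ℝ} {x a : ℝ} (hu : Tendsto u (𝓝[>] x) (𝓝 a)) :
    HasRightTrace u x a := by
  refine tendsto_lintegral_div_of_tendsto hu (fun A hA => ?_) (by simp) fun _ => measurableSet_Ioo
  obtain ⟨l, hl, hlA⟩ := mem_nhdsGT_iff_exists_Ioo_subset.1 hA
  filter_upwards [Ioo_mem_nhdsGT (sub_pos.2 hl)] with r hr
  exact (Ioo_subset_Ioo_right (by linarith [hr.2])).trans hlA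

theorem HasLeftTrace.unique {u : ℝ → ℝ} (hu : Measurable u) {x a b : ℝ}
    (ha : HasLeftTrace u x a) (hb : HasLeftTrace u x b) : a = b :=
  eq_of_tendsto_lintegral_div hu (by simp) ha hb

theorem HasRightTrace.unique {u : ℝ → ℝ} (hu : Measurable u) {x a b : ℝ}
    (ha : HasRightTrace u x a) (hb : HasRightTrace u x b) : a = b :=
  eq_of_tendsto_lintegral_div hu (by simp) ha hb

theorem Monotone.leftTrace_eq {F : ℝ → ℝ} (hF : Monotone F) (x : ℝ) :
    leftTrace F x = Function.leftLim F x := by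
  have h := hasLeftTrace_of_tendsto (hF.tendsto_leftLim x)
  exact (Classical.epsilon_spec ⟨_, h⟩ : HasLeftTrace F x _).unique hF.measurable h

theorem Monotone.rightTrace_eq {F : ℝ → ℝ} (hF : Monotone F) (x : ℝ) :
    rightTrace F x = Function.rightLim F x := by
  have h := hasRightTrace_of_tendsto (hF.tendsto_rightLim x)
  exact (Classical.epsilon_spec ⟨_, h⟩ : HasRightTrace F x _).unique hF.measurable h

theorem Monotone.approxJumpSet_eq {F : ℝ → ℝ} (hF : Monotone F) (α β : ℝ) :
    approxJumpSet α β F = jumpPoints α β F := by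
  ext x
  refine and_congr_right fun _ => ⟨?_, fun h => ?_⟩
  · rintro ⟨a, b, hab, ha, hb⟩
    rwa [(hasLeftTrace_of_tendsto (hF.tendsto_leftLim x)).unique hF.measurable ha,
      (hasRightTrace_of_tendsto (hF.tendsto_rightLim x)).unique hF.measurable hb]
  · exact ⟨_, _, h, hasLeftTrace_of_tendsto (hF.tendsto_leftLim x),
      hasRightTrace_of_tendsto (hF.tendsto_rightLim x)⟩

/-- A monotone function has countably many jumps. -/
theorem Monotone.jumpPoints_countable {F : ℝ → ℝ} (hF : Monotone F) (α β : ℝ) :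
    (jumpPoints α β F).Countable :=
  hF.countable_not_continuousAt.mono fun _ hx hc =>
    hx.2 (hF.continuousAt_iff_leftLim_eq_rightLim.1 hc)

theorem Monotone.jumpSize_nonneg {F : ℝ → ℝ} (hF : Monotone F) (z : ℝ) : 0 ≤ jumpSize F z :=
  sub_nonneg.2 (hF.leftLim_le_rightLim le_rfl)

theorem Monotone.jumpSize_pos {F : ℝ → ℝ} (hF : Monotone F) {α β z : ℝ}
    (hz : z ∈ jumpPoints α β F) : 0 < jumpSize F z :=
  sub_pos.2 ((hF.leftLim_le_rightLim le_rfl).lt_of_ne hz.2)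

theorem Monotone.leftLim_stieltjesFunction {F : ℝ → ℝ} (hF : Monotone F) (z : ℝ) :
    Function.leftLim hF.stieltjesFunction z = Function.leftLim F z :=
  leftLim_rightLim (hF.tendsto_leftLim z)

theorem Monotone.stieltjes_measure_singleton {F : ℝ → ℝ} (hF : Monotone F) (z : ℝ) :
    hF.stieltjesFunction.measure {z} = ENNReal.ofReal (jumpSize F z) := by
  rw [StieltjesFunction.measure_singleton, hF.leftLim_stieltjesFunction, hF.stieltjesFunction_eq,
    jumpSize]

theorem Monotone.stieltjes_measure_Ioo {F : ℝ → ℝ} (hF : Monotone F) (a b : ℝ) :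
    hF.stieltjesFunction.measure (Ioo a b)
      = ENNReal.ofReal (Function.leftLim F b - Function.rightLim F a) := by
  rw [StieltjesFunction.measure_Ioo, hF.leftLim_stieltjesFunction, hF.stieltjesFunction_eq]

theorem Monotone.stieltjes_measure_jumpPoints {F : ℝ → ℝ} (hF : Monotone F) (α β : ℝ) :
    hF.stieltjesFunction.measure (jumpPoints α β F)
      = ∑' z : jumpPoints α β F, ENNReal.ofReal (jumpSize F z) := by
  have := (hF.jumpPoints_countable α β).to_subtype
  conv_lhs => rw [← biUnion_of_singleton (jumpPoints α β F)]
  rw [measure_biUnion (hF.jumpPoints_countable α β) (by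
      intro x _ y _ hxy; simpa [Function.onFun] using hxy)
    fun _ _ => measurableSet_singleton _]
  simp only [hF.stieltjes_measure_singleton]

theorem Monotone.tvK_eq_measure {F : ℝ → ℝ} (hF : Monotone F) (K : ℝ≥0 → ℝ≥0) {α β : ℝ}
    (hαβ : α < β) :
    tvK K α β F = hF.stieltjesFunction.measure (Ioo α β \ jumpPoints α β F)
      + ∑' z : jumpPoints α β F, (K (jumpSize F z).toNNReal : ℝ≥0∞) := by
  have hfin : IsFiniteMeasure (hF.stieltjesFunction.measure.restrict (Ioo α β)) :=
    ⟨by rw [Measure.restrict_apply_univ, hF.stieltjes_measure_Ioo]; exact ENNReal.ofReal_lt_top⟩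
  have hD := hF.isDistribDeriv hαβ
  have hex : ∃ μ : SignedMeasure ℝ, IsDistribDeriv α β F μ := ⟨_, hD⟩
  have hBV : MemBV α β F :=
    ⟨((hF.monotoneOn _).integrableOn_isCompact isCompact_Icc).mono_set Ioo_subset_Icc_self, hex⟩
  have hm : MeasurableSet (Ioo α β \ jumpPoints α β F) :=
    measurableSet_Ioo.diff (hF.jumpPoints_countable α β).measurableSet
  have hspec : IsDistribDeriv α β F (distribDeriv α β F) := by
    rw [distribDeriv, dif_pos hex]; exact hex.choose_spec
  rw [tvK, if_pos hBV, hF.approxJumpSet_eq, hspec.variation_eq hD hm sdiff_subset,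
    Measure.variation_toSignedMeasure, Measure.restrict_apply hm,
    inter_eq_self_of_subset_left sdiff_subset]
  congr 1
  refine tsum_congr fun z => ?_
  rw [hF.rightTrace_eq, hF.leftTrace_eq]
  congr 2
  rw [← jumpSize, Real.toNNReal_eq_nnnorm_of_nonneg (hF.jumpSize_nonneg z)]

theorem jumpPoints_subset_Ioo (α β : ℝ) (F : ℝ → ℝ) : jumpPoints α β F ⊆ Ioo α β :=
  fun _ h => h.1

theorem Monotone.tsum_ofReal_jumpSize_le {F : ℝ → ℝ} (hF : Monotone F) (α β : ℝ) :
    ∑' z : jumpPoints α β F, ENNReal.ofReal (jumpSize F z)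
      ≤ ENNReal.ofReal (Function.leftLim F β - Function.rightLim F α) := by
  rw [← hF.stieltjes_measure_jumpPoints, ← hF.stieltjes_measure_Ioo]
  exact measure_mono (jumpPoints_subset_Ioo α β F)

theorem Monotone.summable_jumpSize {F : ℝ → ℝ} (hF : Monotone F) (α β : ℝ) :
    Summable fun z : jumpPoints α β F => jumpSize F z := by
  have h := ENNReal.summable_toReal
    ((hF.tsum_ofReal_jumpSize_le α β).trans_lt ENNReal.ofReal_lt_top).ne
  simpa only [ENNReal.toReal_ofReal (hF.jumpSize_nonneg _)] using h

theorem Monotone.tsum_jumpSize_le {F : ℝ → ℝ} (hF : Monotone F) {α β : ℝ} (hαβ : α < β) :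
    ∑' z : jumpPoints α β F, jumpSize F z ≤ Function.leftLim F β - Function.rightLim F α := by
  have h := hF.tsum_ofReal_jumpSize_le α β
  rwa [← ENNReal.ofReal_tsum_of_nonneg (fun z : jumpPoints α β F => hF.jumpSize_nonneg z) (hF.summable_jumpSize α β),
    ENNReal.ofReal_le_ofReal_iff (sub_nonneg.2 (hF.rightLim_le_leftLim hαβ))] at h

theorem Monotone.tvK_eq {F : ℝ → ℝ} (hF : Monotone F) (K : ℝ≥0 → ℝ≥0) {α β : ℝ}
    (hαβ : α < β) :
    tvK K α β F = ENNReal.ofReal (Function.leftLim F β - Function.rightLim F α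
        - ∑' z : jumpPoints α β F, jumpSize F z)
      + ∑' z : jumpPoints α β F, (K (jumpSize F z).toNNReal : ℝ≥0∞) := by
  have hS := ENNReal.ofReal_tsum_of_nonneg (fun z : jumpPoints α β F => hF.jumpSize_nonneg z)
    (hF.summable_jumpSize α β)
  rw [hF.tvK_eq_measure K hαβ, measure_sdiff (jumpPoints_subset_Ioo α β F)
      (hF.jumpPoints_countable α β).measurableSet.nullMeasurableSet,
    hF.stieltjes_measure_Ioo, hF.stieltjes_measure_jumpPoints, ← hS,
    ENNReal.ofReal_sub _ (tsum_nonneg fun z : jumpPoints α β F => hF.jumpSize_nonneg z)]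
  rw [hF.stieltjes_measure_jumpPoints, ← hS]
  exact ENNReal.ofReal_ne_top

/-- The monotone one-jump function. -/
noncomputable def stepFun (γ a b : ℝ) (x : ℝ) : ℝ := if x < γ then a else b

theorem stepFun_monotone {γ a b : ℝ} (hab : a ≤ b) : Monotone (stepFun γ a b) := by
  intro x y hxy
  unfold stepFun
  split_ifs with h1 h2 <;> first | exact le_rfl | exact hab | linarith

theorem stepFun_eventuallyEq_left {γ a b x : ℝ} (hx : x < γ) : stepFun γ a b =ᶠ[𝓝 x] fun _ => a := by
  filter_upwards [Iio_mem_nhds hx] with y hy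
  exact if_pos hy

theorem stepFun_eventuallyEq_right {γ a b x : ℝ} (hx : γ < x) :
    stepFun γ a b =ᶠ[𝓝 x] fun _ => b := by
  filter_upwards [Ioi_mem_nhds hx] with y hy
  exact if_neg (not_lt.2 (le_of_lt hy))

theorem stepFun_leftLim_self (γ a b : ℝ) : Function.leftLim (stepFun γ a b) γ = a := by
  refine leftLim_eq_of_tendsto (tendsto_const_nhds.congr' ?_)
  filter_upwards [self_mem_nhdsWithin] with y hy
  exact (if_pos hy).symm

theorem stepFun_rightLim_self (γ a b : ℝ) : Function.rightLim (stepFun γ a b) γ = b := by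
  refine rightLim_eq_of_tendsto (tendsto_const_nhds.congr' ?_)
  filter_upwards [self_mem_nhdsWithin] with y hy
  exact (if_neg (not_lt.2 (le_of_lt hy))).symm

theorem stepFun_continuousAt {γ a b x : ℝ} (hx : x ≠ γ) : ContinuousAt (stepFun γ a b) x := by
  rcases hx.lt_or_gt with h | h
  · exact continuousAt_const.congr (stepFun_eventuallyEq_left h).symm
  · exact continuousAt_const.congr (stepFun_eventuallyEq_right h).symm

theorem tvK_stepFun (K : ℝ≥0 → ℝ≥0) {α β γ a b : ℝ} (hγ : γ ∈ Ioo α β) (hab : a < b) :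
    tvK K α β (stepFun γ a b) = K (b - a).toNNReal := by
  have hJ : jumpPoints α β (stepFun γ a b) = {γ} := by
    ext x
    constructor
    · rintro ⟨-, hx⟩
      by_contra hne
      exact hx ((stepFun_monotone hab.le).continuousAt_iff_leftLim_eq_rightLim.1
        (stepFun_continuousAt hne))
    · rintro rfl
      exact ⟨hγ, by rw [stepFun_leftLim_self, stepFun_rightLim_self]; exact hab.ne⟩
  have hs : jumpSize (stepFun γ a b) γ = b - a := by
    rw [jumpSize, stepFun_leftLim_self, stepFun_rightLim_self]
  have hα : Function.rightLim (stepFun γ a b) α = a := by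
    rw [(stepFun_continuousAt hγ.1.ne).continuousWithinAt.rightLim_eq]; exact if_pos hγ.1
  have hβ : Function.leftLim (stepFun γ a b) β = b := by
    rw [(stepFun_continuousAt hγ.2.ne').continuousWithinAt.leftLim_eq]
    exact if_neg (not_lt.2 hγ.2.le)
  rw [(stepFun_monotone hab.le).tvK_eq K (hγ.1.trans hγ.2), hJ, hα, hβ,
    tsum_singleton γ (fun z => jumpSize (stepFun γ a b) z),
    tsum_singleton γ (fun z => (K (jumpSize (stepFun γ a b) z).toNNReal : ℝ≥0∞)), hs]
  simp

theorem IsK2Const.sum_le {K : ℝ≥0 → ℝ≥0} (hK0 : K 0 = 0) {M C : ℝ} (h : IsK2Const K M C)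
    {ι : Type*} (t : Finset ι) (x : ι → ℝ≥0) (hx : ((∑ i ∈ t, x i : ℝ≥0) : ℝ) ≤ M) :
    (K (∑ i ∈ t, x i) : ℝ) + C / 2 * ((∑ i ∈ t, (x i : ℝ)) ^ 2 - ∑ i ∈ t, (x i : ℝ) ^ 2)
      ≤ ∑ i ∈ t, (K (x i) : ℝ) := by
  classical
  induction t using Finset.induction_on with
  | empty => simp [hK0]
  | insert a t ha ih =>
    rw [Finset.sum_insert ha, NNReal.coe_add] at hx
    have h1 := ih (by linarith [(x a).2])
    have h2 := h.ineq (x a) (∑ i ∈ t, x i) hx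
    rw [NNReal.coe_sum] at h2
    simp only [Finset.sum_insert ha]
    linarith

theorem IsK2Const.add_sum_le {K : ℝ≥0 → ℝ≥0} (hK0 : K 0 = 0) (hK3 : CondK3 K) {M C : ℝ}
    (h : IsK2Const K M C) {ι : Type*} (t : Finset ι) (x : ι → ℝ≥0) (d : ℝ≥0)
    (hx : ((d + ∑ i ∈ t, x i : ℝ≥0) : ℝ) ≤ M) :
    (K (d + ∑ i ∈ t, x i) : ℝ)
        + C / 2 * ((d + ∑ i ∈ t, (x i : ℝ)) ^ 2 - ∑ i ∈ t, (x i : ℝ) ^ 2)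
      ≤ d + ∑ i ∈ t, (K (x i) : ℝ) := by
  rcases eq_or_ne d 0 with rfl | hd
  · simpa using h.sum_le hK0 t x (by simpa using hx)
  have hd0 : (0 : ℝ) < d := by positivity
  -- split `d` into `n + 1` equal parts
  have hstep : ∀ n : ℕ, (K (d + ∑ i ∈ t, x i) : ℝ)
        + C / 2 * ((d + ∑ i ∈ t, (x i : ℝ)) ^ 2 - (d * (d / (n + 1 : ℝ)) + ∑ i ∈ t, (x i : ℝ) ^ 2))
      ≤ d * ((K (d / (n + 1)) / (d / (n + 1)) : ℝ≥0) : ℝ) + ∑ i ∈ t, (K (x i) : ℝ) := by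
    intro n
    have hn : (n + 1 : ℝ) ≠ 0 := by positivity
    have hn' : (n + 1 : ℝ≥0) ≠ 0 := by positivity
    have hs : ∑ i ∈ (Finset.range (n + 1)).disjSum t, Sum.elim (fun _ => d / (n + 1)) x i
        = d + ∑ i ∈ t, x i := by
      rw [Finset.sum_disjSum]
      simp [mul_div_cancel₀, hn']
    have := h.sum_le hK0 ((Finset.range (n + 1)).disjSum t)
      (Sum.elim (fun _ => d / (n + 1)) x) (by rw [hs]; exact hx)
    rw [hs] at this
    simp only [Finset.sum_disjSum, Sum.elim_inl, Sum.elim_inr, Finset.sum_const,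
      Finset.card_range, nsmul_eq_mul] at this
    push_cast at this ⊢
    have e1 : (n + 1 : ℝ) * (d / (n + 1)) = d := by field_simp
    have e2 : (n + 1 : ℝ) * (d / (n + 1)) ^ 2 = d * (d / (n + 1)) := by field_simp
    have e3 : (n + 1 : ℝ) * (K (d / (n + 1)) : ℝ)
        = d * ((K (d / (n + 1)) : ℝ) / (d / (n + 1))) := by field_simp
    rw [e1, e2, e3] at this
    exact this
  have hlim0 : Tendsto (fun n : ℕ => (d : ℝ) / (n + 1 : ℝ)) atTop (𝓝 0) :=
    tendsto_const_div_atTop_nhds_zero_nat (d : ℝ) |>.comp (tendsto_add_atTop_nat 1)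
      |>.congr fun n => by simp
  have hlimN : Tendsto (fun n : ℕ => d / (n + 1 : ℝ≥0)) atTop (𝓝[>] 0) := by
    refine tendsto_nhdsWithin_iff.2 ⟨?_, Eventually.of_forall fun n => ?_⟩
    · rw [← NNReal.tendsto_coe]
      push_cast
      exact hlim0
    · exact div_pos (pos_iff_ne_zero.2 hd) (by positivity)
  have hlimK : Tendsto (fun n : ℕ => ((K (d / (n + 1)) / (d / (n + 1)) : ℝ≥0) : ℝ)) atTop
      (𝓝 (1 : ℝ)) := by
    have := (NNReal.tendsto_coe.2 (hK3.comp hlimN))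
    simpa [Function.comp_def] using this
  have := le_of_tendsto_of_tendsto'
    ((tendsto_const_nhds (x := (K (d + ∑ i ∈ t, x i) : ℝ))).add
      (((tendsto_const_nhds (x := ((d : ℝ) + ∑ i ∈ t, (x i : ℝ)) ^ 2)).sub
        ((hlim0.const_mul (d : ℝ)).add_const (∑ i ∈ t, (x i : ℝ) ^ 2))).const_mul (C / 2)))
    ((hlimK.const_mul (d : ℝ)).add_const (∑ i ∈ t, (K (x i) : ℝ))) hstep
  simpa using this

theorem IsK2Const.ofReal_le_add_tsum {K : ℝ≥0 → ℝ≥0} (hK1 : CondK1 K) (hK3 : CondK3 K) {M C : ℝ}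
    (h : IsK2Const K M C) {ι : Type*} (x : ι → ℝ≥0) (hx : Summable fun i => (x i : ℝ))
    (hx2 : Summable fun i => (x i : ℝ) ^ 2) (ρ : ℝ≥0) (hρM : (ρ : ℝ) ≤ M)
    (hxρ : ∑' i, (x i : ℝ) ≤ ρ) :
    ENNReal.ofReal ((K ρ : ℝ) + C / 2 * ((ρ : ℝ) ^ 2 - ∑' i, (x i : ℝ) ^ 2))
      ≤ ENNReal.ofReal (ρ - ∑' i, (x i : ℝ)) + ∑' i, (K (x i) : ℝ≥0∞) := by
  set d : ℝ≥0 := ⟨ρ - ∑' i, (x i : ℝ), sub_nonneg.2 hxρ⟩ with hd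
  have hdr : (d : ℝ) = ρ - ∑' i, (x i : ℝ) := rfl
  have hsum : ∀ t : Finset ι, ∑ i ∈ t, (x i : ℝ) ≤ ∑' i, (x i : ℝ) := fun t =>
    hx.sum_le_tsum t fun i _ => (x i).2
  have hlim : Tendsto (fun t : Finset ι => (d : ℝ) + ∑ i ∈ t, (x i : ℝ)) atTop (𝓝 (ρ : ℝ)) := by
    have := (hx.hasSum : Tendsto _ _ _).const_add (d : ℝ)
    rwa [hdr, sub_add_cancel] at this
  have hlimN : Tendsto (fun t : Finset ι => d + ∑ i ∈ t, x i) atTop (𝓝 ρ) := by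
    rw [← NNReal.tendsto_coe]
    push_cast
    exact hlim
  have hfin : ∀ t : Finset ι, ENNReal.ofReal ((K (d + ∑ i ∈ t, x i) : ℝ)
      + C / 2 * ((d + ∑ i ∈ t, (x i : ℝ)) ^ 2 - ∑ i ∈ t, (x i : ℝ) ^ 2))
        ≤ ENNReal.ofReal (ρ - ∑' i, (x i : ℝ)) + ∑' i, (K (x i) : ℝ≥0∞) := fun t => by
    have h1 := h.add_sum_le hK1.zero hK3 t x d (by
      push_cast; linarith [hsum t])
    calc _ ≤ ENNReal.ofReal (d + ∑ i ∈ t, (K (x i) : ℝ)) := ENNReal.ofReal_le_ofReal h1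
      _ = ENNReal.ofReal (ρ - ∑' i, (x i : ℝ)) + ∑ i ∈ t, (K (x i) : ℝ≥0∞) := by
        rw [ENNReal.ofReal_add d.coe_nonneg (Finset.sum_nonneg fun i _ => (K (x i)).coe_nonneg), hdr,
          ENNReal.ofReal_sum_of_nonneg fun i _ => (K (x i)).coe_nonneg]
        simp
      _ ≤ _ := by gcongr; exact ENNReal.sum_le_tsum t
  have hlow : ∀ y : ℝ, y < K ρ →
      ENNReal.ofReal (y + C / 2 * ((ρ : ℝ) ^ 2 - ∑' i, (x i : ℝ) ^ 2))
      ≤ ENNReal.ofReal (ρ - ∑' i, (x i : ℝ)) + ∑' i, (K (x i) : ℝ≥0∞) := by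
    intro y hy
    have hev : ∀ᶠ t : Finset ι in atTop, y ≤ (K (d + ∑ i ∈ t, x i) : ℝ) := by
      rcases lt_or_ge y 0 with h0 | h0
      · exact Eventually.of_forall fun t => h0.le.trans (K _).2
      · lift y to ℝ≥0 using h0
        filter_upwards [hlimN.eventually (hK1.lsc ρ y (by exact_mod_cast hy))] with t ht
        exact_mod_cast ht.le
    have hl : Tendsto (fun t : Finset ι => ENNReal.ofReal
        (y + C / 2 * ((d + ∑ i ∈ t, (x i : ℝ)) ^ 2 - ∑ i ∈ t, (x i : ℝ) ^ 2))) atTop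
        (𝓝 (ENNReal.ofReal (y + C / 2 * ((ρ : ℝ) ^ 2 - ∑' i, (x i : ℝ) ^ 2)))) :=
      ENNReal.tendsto_ofReal
        ((((hlim.pow 2).sub (hx2.hasSum : Tendsto _ _ _)).const_mul (C / 2)).const_add y)
    refine le_of_tendsto hl ?_
    filter_upwards [hev] with t ht
    exact (ENNReal.ofReal_le_ofReal (by linarith)).trans (hfin t)
  have hl : Tendsto (fun y : ℝ => ENNReal.ofReal
      (y + C / 2 * ((ρ : ℝ) ^ 2 - ∑' i, (x i : ℝ) ^ 2))) (𝓝[<] (K ρ : ℝ))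
      (𝓝 (ENNReal.ofReal ((K ρ : ℝ) + C / 2 * ((ρ : ℝ) ^ 2 - ∑' i, (x i : ℝ) ^ 2)))) :=
    ENNReal.tendsto_ofReal ((tendsto_id.mono_left nhdsWithin_le_nhds).add_const _)
  refine le_of_tendsto hl ?_
  filter_upwards [self_mem_nhdsWithin] with y hy using hlow y hy

theorem Monotone.sum_jumpSize_le {F : ℝ → ℝ} (hF : Monotone F) {a b : ℝ} (hab : a < b)
    (t : Finset ℝ) (ht : ∀ z ∈ t, z ∈ Ioo a b) :
    ∑ z ∈ t, jumpSize F z ≤ Function.leftLim F b - Function.rightLim F a := by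
  have h : ENNReal.ofReal (∑ z ∈ t, jumpSize F z)
      ≤ ENNReal.ofReal (Function.leftLim F b - Function.rightLim F a) := by
    rw [ENNReal.ofReal_sum_of_nonneg fun z _ => hF.jumpSize_nonneg z, ← hF.stieltjes_measure_Ioo]
    simp only [← hF.stieltjes_measure_singleton]
    rw [sum_measure_singleton]
    exact measure_mono fun z hz => ht z hz
  rwa [ENNReal.ofReal_le_ofReal_iff (sub_nonneg.2 (hF.rightLim_le_leftLim hab))] at h

theorem Monotone.summable_jumpSize_sq {F : ℝ → ℝ} (hF : Monotone F) (α β : ℝ) :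
    Summable fun z : jumpPoints α β F => jumpSize F z ^ 2 := by
  refine Summable.of_nonneg_of_le (fun z => sq_nonneg _) (fun z => ?_)
    ((hF.summable_jumpSize α β).mul_left (∑' z : jumpPoints α β F, jumpSize F z))
  rw [sq]
  exact mul_le_mul_of_nonneg_right
    ((hF.summable_jumpSize α β).le_tsum z fun w _ => hF.jumpSize_nonneg w) (hF.jumpSize_nonneg z)

/-- The jumps on the two sides of a continuity point are controlled by the increments there. -/
theorem Monotone.tsum_jumpSize_sq_le {F : ℝ → ℝ} (hF : Monotone F) {α β x : ℝ}
    (hx : x ∈ Ioo α β) (hc : ContinuousAt F x) :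
    ∑' z : jumpPoints α β F, jumpSize F z ^ 2
      ≤ (F x - Function.rightLim F α) ^ 2 + (Function.leftLim F β - F x) ^ 2 := by
  refine (hF.summable_jumpSize_sq α β).tsum_le_of_sum_le fun t => ?_
  have e : ∑ z ∈ t, jumpSize F z ^ 2
      = ∑ z ∈ t.map (Function.Embedding.subtype _), jumpSize F z ^ 2 := by simp
  have hmem : ∀ z ∈ t.map (Function.Embedding.subtype (· ∈ jumpPoints α β F)),
      z ∈ jumpPoints α β F := by
    intro z hz
    obtain ⟨w, -, rfl⟩ := Finset.mem_map.1 hz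
    exact w.2
  rw [e]
  set T := t.map (Function.Embedding.subtype (· ∈ jumpPoints α β F))
  have hne : ∀ z ∈ T, z ≠ x := fun z hz h =>
    (hmem z hz).2 (hF.continuousAt_iff_leftLim_eq_rightLim.1 (h ▸ hc))
  rw [← Finset.sum_filter_add_sum_filter_not T (· < x)]
  have h1 := hF.sum_jumpSize_le hx.1 (T.filter (· < x)) fun z hz =>
    ⟨(hmem z (Finset.mem_filter.1 hz).1).1.1, (Finset.mem_filter.1 hz).2⟩
  have h2 := hF.sum_jumpSize_le hx.2 (T.filter (¬ · < x)) fun z hz =>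
    ⟨(not_lt.1 (Finset.mem_filter.1 hz).2).lt_of_ne' (hne z (Finset.mem_filter.1 hz).1),
      (hmem z (Finset.mem_filter.1 hz).1).1.2⟩
  rw [hc.continuousWithinAt.leftLim_eq] at h1
  rw [hc.continuousWithinAt.rightLim_eq] at h2
  refine add_le_add ?_ ?_
  · refine (Finset.sum_sq_le_sq_sum_of_nonneg fun z _ => hF.jumpSize_nonneg z).trans ?_
    exact pow_le_pow_left₀ (Finset.sum_nonneg fun z _ => hF.jumpSize_nonneg z) h1 2
  · refine (Finset.sum_sq_le_sq_sum_of_nonneg fun z _ => hF.jumpSize_nonneg z).trans ?_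
    exact pow_le_pow_left₀ (Finset.sum_nonneg fun z _ => hF.jumpSize_nonneg z) h2 2

/-- Averaging over the jump position with respect to the derivative of `F`. -/
theorem Monotone.exists_stepFun_lintegral_le {F g : ℝ → ℝ} (hF : Monotone F) (hg : Measurable g)
    {α β a b B : ℝ} (hab : a < b) (hαβ : α < β) (ha : Function.rightLim F α = a)
    (hb : Function.leftLim F β = b)
    (hB : ∀ x ∈ Ioo α β, ContinuousAt F x → (F x - a) * (b - F x) ≤ B) :
    ∃ γ ∈ Ioo α β, ∫⁻ x in Ioo α β, ‖stepFun γ a b x - g x‖ₑ ^ 2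
      ≤ (∫⁻ x in Ioo α β, ‖F x - g x‖ₑ ^ 2) + ENNReal.ofReal (B * (β - α)) := by
  have hsq : ∀ y : ℝ, ‖y‖ₑ ^ 2 = ENNReal.ofReal (y ^ 2) := fun y => by
    rw [← sq_abs, ENNReal.ofReal_pow (abs_nonneg y), Real.enorm_eq_ofReal_abs]
  set ν := hF.stieltjesFunction.measure with hν
  have hνI : ν (Ioo α β) = ENNReal.ofReal (b - a) := by
    rw [hν, hF.stieltjes_measure_Ioo, ha, hb]
  have hρ : 0 < b - a := sub_pos.2 hab
  have : IsFiniteMeasure (ν.restrict (Ioo α β)) :=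
    ⟨by rw [Measure.restrict_apply_univ, hνI]; exact ENNReal.ofReal_lt_top⟩
  have hmeas : Measurable fun q : ℝ × ℝ => ‖stepFun q.1 a b q.2 - g q.2‖ₑ ^ 2 := by
    have : Measurable fun q : ℝ × ℝ => stepFun q.1 a b q.2 := by
      unfold stepFun
      exact Measurable.ite (measurableSet_lt measurable_snd measurable_fst) measurable_const
        measurable_const
    exact ((this.sub (hg.comp measurable_snd)).enorm).pow_const 2
  obtain ⟨γ, hγ, hle⟩ := exists_le_setLAverage (μ := ν) (s := Ioo α β)
    (f := fun γ => ∫⁻ x in Ioo α β, ‖stepFun γ a b x - g x‖ₑ ^ 2)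
    (by rw [hνI]; simpa using hab) (by rw [hνI]; exact ENNReal.ofReal_ne_top)
    (hmeas.lintegral_prod_right (ν := volume.restrict (Ioo α β))).aemeasurable
  refine ⟨γ, hγ, hle.trans ?_⟩
  rw [setLAverage_eq, hνI]
  refine ENNReal.div_le_of_le_mul ?_
  rw [lintegral_lintegral_swap hmeas.aemeasurable]
  have hpt : ∀ᵐ x ∂volume.restrict (Ioo α β),
      ∫⁻ γ in Ioo α β, ‖stepFun γ a b x - g x‖ₑ ^ 2 ∂ν
        ≤ (‖F x - g x‖ₑ ^ 2 + ENNReal.ofReal B) * ENNReal.ofReal (b - a) := by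
    rw [ae_restrict_iff' measurableSet_Ioo]
    have : ∀ᵐ x : ℝ, x ∉ {x | ¬ ContinuousAt F x} :=
      hF.countable_not_continuousAt.ae_notMem _
    filter_upwards [this] with x hx hxI
    have hc : ContinuousAt F x := not_not.1 hx
    have hsplit : Ioo α β = Ioc α x ∪ Ioo x β := (Ioc_union_Ioo_eq_Ioo hxI.1.le hxI.2).symm
    have hFa : a ≤ F x := ha ▸ hF.rightLim_le hxI.1
    have hFb : F x ≤ b := hb ▸ hF.le_leftLim hxI.2
    have hB0 : 0 ≤ B := (mul_nonneg (sub_nonneg.2 hFa) (sub_nonneg.2 hFb)).trans (hB x hxI hc)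
    have hdisj : Disjoint (Ioc α x) (Ioo x β) :=
      disjoint_left.2 fun y h1 h2 => (h1.2.trans_lt h2.1).false
    have i1 : ∫⁻ γ in Ioc α x, ‖stepFun γ a b x - g x‖ₑ ^ 2 ∂ν
        = ENNReal.ofReal ((b - g x) ^ 2 * (F x - a)) := by
      rw [setLIntegral_congr_fun measurableSet_Ioc (g := fun _ => ENNReal.ofReal ((b - g x) ^ 2)),
        setLIntegral_const, hν, StieltjesFunction.measure_Ioc, hF.stieltjesFunction_eq,
        hF.stieltjesFunction_eq, hc.continuousWithinAt.rightLim_eq, ha,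
        ENNReal.ofReal_mul (sq_nonneg _)]
      intro y hy
      simp only [stepFun, if_neg (not_lt.2 hy.2), hsq]
    have i2 : ∫⁻ γ in Ioo x β, ‖stepFun γ a b x - g x‖ₑ ^ 2 ∂ν
        = ENNReal.ofReal ((a - g x) ^ 2 * (b - F x)) := by
      rw [setLIntegral_congr_fun measurableSet_Ioo (g := fun _ => ENNReal.ofReal ((a - g x) ^ 2)),
        setLIntegral_const, hν, hF.stieltjes_measure_Ioo, hc.continuousWithinAt.rightLim_eq, hb,
        ENNReal.ofReal_mul (sq_nonneg _)]
      intro y hy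
      simp only [stepFun, if_pos hy.1, hsq]
    rw [hsplit, lintegral_union measurableSet_Ioo hdisj, i1, i2, hsq,
      ← ENNReal.ofReal_add (mul_nonneg (sq_nonneg _) (sub_nonneg.2 hFa))
        (mul_nonneg (sq_nonneg _) (sub_nonneg.2 hFb)),
      ← ENNReal.ofReal_add (sq_nonneg _) hB0, ← ENNReal.ofReal_mul (by positivity)]
    refine ENNReal.ofReal_le_ofReal ?_
    have := mul_le_mul_of_nonneg_right (hB x hxI hc) hρ.le
    linarith [show (b - g x) ^ 2 * (F x - a) + (a - g x) ^ 2 * (b - F x)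
      = (F x - g x) ^ 2 * (b - a) + (F x - a) * (b - F x) * (b - a) by ring]
  refine (lintegral_mono_ae hpt).trans ?_
  rw [lintegral_mul_const' _ _ ENNReal.ofReal_ne_top, lintegral_add_right _ measurable_const,
    setLIntegral_const, Real.volume_Ioo, ← ENNReal.ofReal_mul' (sub_pos.2 hαβ).le]

theorem tsum_sq_le_sq_tsum {ι : Type*} {x : ι → ℝ} (h0 : ∀ i, 0 ≤ x i) (hx : Summable x)
    (hx2 : Summable fun i => x i ^ 2) : ∑' i, x i ^ 2 ≤ (∑' i, x i) ^ 2 :=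
  hx2.tsum_le_of_sum_le fun t => (Finset.sum_sq_le_sq_sum_of_nonneg fun i _ => h0 i).trans <|
    pow_le_pow_left₀ (Finset.sum_nonneg fun i _ => h0 i) (hx.sum_le_tsum t fun i _ => h0 i) 2

theorem sq_tsum_sub_tsum_sq_add_eq_zero_iff {ι : Type*} {x : ι → ℝ} {ρ : ℝ} (h0 : ∀ i, 0 < x i)
    (hx : Summable x) (hx2 : Summable fun i => x i ^ 2) (hxρ : ∑' i, x i ≤ ρ) (hρ : 0 < ρ) :
    (∑' i, x i) ^ 2 - ∑' i, x i ^ 2 + (ρ - ∑' i, x i) ^ 2 = 0 ↔ ∃ i, x i = ρ := by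
  have hle := tsum_sq_le_sq_tsum (fun i => (h0 i).le) hx hx2
  have hi : ∀ i, x i ≤ ∑' i, x i := fun i => hx.le_tsum i fun j _ => (h0 j).le
  constructor
  · intro h
    have hS : ∑' i, x i = ρ := by nlinarith [sq_nonneg (ρ - ∑' i, x i)]
    have hQ : ∑' i, x i ^ 2 = ρ ^ 2 := by rw [hS] at h; linarith
    have hsum : ∑' i, x i * (ρ - x i) = 0 := by
      have e : ∀ i, x i * (ρ - x i) = ρ * x i - x i ^ 2 := fun i => by ring
      simp only [e]
      rw [(hx.mul_left ρ).tsum_sub hx2, tsum_mul_left, hS, hQ]; ring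
    have hne : Nonempty ι := by
      by_contra hemp
      rw [not_nonempty_iff] at hemp
      rw [tsum_empty] at hS
      exact hρ.ne hS
    obtain ⟨i⟩ := hne
    have hnn : ∀ i, 0 ≤ x i * (ρ - x i) := fun i =>
      mul_nonneg (h0 i).le (sub_nonneg.2 ((hi i).trans hxρ))
    have hsm : Summable fun i => x i * (ρ - x i) :=
      ((hx.mul_left ρ).sub hx2).congr fun i => by ring
    have := hsm.le_tsum i fun j _ => hnn j
    rw [hsum] at this
    have hz := (mul_eq_zero.1 (le_antisymm this (hnn i))).resolve_left (h0 i).ne'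
    exact ⟨i, by linarith⟩
  · rintro ⟨i, rfl⟩
    have hS : ∑' j, x j = x i := le_antisymm hxρ (hi i)
    have hQ : x i ^ 2 ≤ ∑' j, x j ^ 2 := hx2.le_tsum i fun j _ => sq_nonneg _
    rw [hS] at hle ⊢
    linarith

theorem stepFun_isOneJump {α β γ : ℝ} (hγ : γ ∈ Ioo α β) (g : ℝ → ℝ) :
    IsOneJump α β g (stepFun γ (g α) (g β)) :=
  ⟨γ, hγ, fun _ hx => if_pos hx.2, fun _ hx => if_neg (not_lt.2 hx.1.le)⟩

theorem Monotone.jumpTerm_le {F : ℝ → ℝ} (hF : Monotone F) {α β ρ : ℝ} (hαβ : α < β)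
    (hρ : ρ = Function.leftLim F β - Function.rightLim F α) :
    jumpTerm α β ρ F ≤ ρ ^ 2 - ∑' z : jumpPoints α β F, jumpSize F z ^ 2 := by
  have h1 := hF.tsum_jumpSize_le hαβ
  have h0 : 0 ≤ ∑' z : jumpPoints α β F, jumpSize F z := tsum_nonneg fun z => hF.jumpSize_nonneg z
  rw [← hρ] at h1
  unfold jumpTerm
  nlinarith [mul_nonneg h0 (sub_nonneg.2 h1)]

/-- The energy gap between a monotone function and some one-jump function. -/
theorem Monotone.exists_stepFun_tvKg_add_le {F g : ℝ → ℝ} (hF : Monotone F) (hg : Measurable g)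
    {K : ℝ≥0 → ℝ≥0} (hK1 : CondK1 K) (hK3 : CondK3 K) {M C lam α β a b : ℝ}
    (hC : IsK2Const K M C) (hM : b - a ≤ M) (hlam : 0 < lam) (hαβ : α < β) (hab : a < b)
    (ha : Function.rightLim F α = a) (hb : Function.leftLim F β = b)
    (hCstar : 0 < C - lam * (β - α) / 2) :
    ∃ γ ∈ Ioo α β, tvKg K lam α β g (stepFun γ a b)
        + ENNReal.ofReal ((C - lam * (β - α) / 2) / 2 * jumpTerm α β (b - a) F)
      ≤ tvKg K lam α β g F := by
  set Q := ∑' z : jumpPoints α β F, jumpSize F z ^ 2 with hQ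
  have hT : jumpTerm α β (b - a) F ≤ (b - a) ^ 2 - Q := hF.jumpTerm_le hαβ (by rw [ha, hb])
  have hB : ∀ x ∈ Ioo α β, ContinuousAt F x → (F x - a) * (b - F x) ≤ ((b - a) ^ 2 - Q) / 2 := by
    intro x hx hc
    have := hF.tsum_jumpSize_sq_le hx hc
    rw [ha, hb] at this
    nlinarith
  have hQ0 : 0 ≤ (b - a) ^ 2 - Q := by
    have h1 := tsum_sq_le_sq_tsum (fun z : jumpPoints α β F => hF.jumpSize_nonneg z)
      (hF.summable_jumpSize α β) (hF.summable_jumpSize_sq α β)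
    have h2 := hF.tsum_jumpSize_le hαβ
    rw [ha, hb] at h2
    have h3 := pow_le_pow_left₀ (tsum_nonneg fun z : jumpPoints α β F => hF.jumpSize_nonneg z) h2 2
    linarith
  obtain ⟨γ, hγ, hle⟩ := hF.exists_stepFun_lintegral_le hg hab hαβ ha hb hB
  refine ⟨γ, hγ, ?_⟩
  have hρ : ((b - a).toNNReal : ℝ) = b - a := Real.coe_toNNReal _ (sub_pos.2 hab).le
  have hx : ∀ z : jumpPoints α β F, ((jumpSize F z).toNNReal : ℝ) = jumpSize F z := fun z =>
    Real.coe_toNNReal _ (hF.jumpSize_nonneg z)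
  have hK := hC.ofReal_le_add_tsum hK1 hK3
    (fun z : jumpPoints α β F => (jumpSize F z).toNNReal)
    (by simpa only [hx] using hF.summable_jumpSize α β)
    (by simpa only [hx] using hF.summable_jumpSize_sq α β) (b - a).toNNReal (by rwa [hρ])
    (by simpa only [hx, hρ, ha, hb] using hF.tsum_jumpSize_le hαβ)
  simp only [hx, hρ] at hK
  have hC0 := hC.pos
  rw [tvKg, tvKg, tvK_stepFun K hγ hab, hF.tvK_eq K hαβ, ha, hb]
  have hfid : fidelity lam α β g (stepFun γ a b) ≤ fidelity lam α β g F
      + ENNReal.ofReal (lam / 2 * (((b - a) ^ 2 - Q) / 2 * (β - α))) := by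
    rw [fidelity, fidelity, ENNReal.ofReal_mul (by positivity), ← mul_add]
    gcongr
  have hnum : ENNReal.ofReal (lam / 2 * (((b - a) ^ 2 - Q) / 2 * (β - α)))
      + ENNReal.ofReal ((C - lam * (β - α) / 2) / 2 * jumpTerm α β (b - a) F)
      ≤ ENNReal.ofReal (C / 2 * ((b - a) ^ 2 - Q)) := by
    have h1 : 0 ≤ lam / 2 * (((b - a) ^ 2 - Q) / 2 * (β - α)) :=
      mul_nonneg (by positivity) (mul_nonneg (by linarith) (sub_pos.2 hαβ).le)
    calc _ ≤ ENNReal.ofReal (lam / 2 * (((b - a) ^ 2 - Q) / 2 * (β - α)))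
          + ENNReal.ofReal ((C - lam * (β - α) / 2) / 2 * ((b - a) ^ 2 - Q)) := by
          gcongr
      _ = _ := by
        rw [← ENNReal.ofReal_add h1 (mul_nonneg (by linarith) hQ0)]
        congr 1; ring
  calc _ ≤ (K (b - a).toNNReal : ℝ≥0∞) + (fidelity lam α β g F
          + ENNReal.ofReal (lam / 2 * (((b - a) ^ 2 - Q) / 2 * (β - α))))
        + ENNReal.ofReal ((C - lam * (β - α) / 2) / 2 * jumpTerm α β (b - a) F) := by gcongr
    _ = (K (b - a).toNNReal : ℝ≥0∞)
        + (ENNReal.ofReal (lam / 2 * (((b - a) ^ 2 - Q) / 2 * (β - α)))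
        + ENNReal.ofReal ((C - lam * (β - α) / 2) / 2 * jumpTerm α β (b - a) F))
        + fidelity lam α β g F := by ring
    _ ≤ (K (b - a).toNNReal : ℝ≥0∞) + ENNReal.ofReal (C / 2 * ((b - a) ^ 2 - Q))
        + fidelity lam α β g F := by gcongr
    _ = ENNReal.ofReal ((K (b - a).toNNReal : ℝ) + C / 2 * ((b - a) ^ 2 - Q))
        + fidelity lam α β g F := by
        rw [ENNReal.ofReal_add (NNReal.coe_nonneg _) (mul_nonneg (by linarith) hQ0),
          ENNReal.ofReal_coe_nnreal]
    _ ≤ _ := by gcongr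

/-- The monotone extension of a function from `[α, β]` to the line. -/
theorem MonotoneOn.exists_monotone_eqOn_Icc {v : ℝ → ℝ} {α β : ℝ} (hαβ : α ≤ β)
    (hv : MonotoneOn v (Icc α β)) : ∃ F : ℝ → ℝ, Monotone F ∧ EqOn F v (Icc α β) :=
  ⟨IccExtend hαβ ((Icc α β).domRestrict v),
    Monotone.IccExtend hαβ (fun x y h => hv x.2 y.2 h),
    fun _ hx => IccExtend_of_mem hαβ _ hx⟩

theorem leftLim_congr_of_eqOn_Icc {F v : ℝ → ℝ} (hF : Monotone F) {α β : ℝ}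
    (h : EqOn F v (Icc α β)) {z : ℝ} (hz : z ∈ Ioc α β) :
    Function.leftLim v z = Function.leftLim F z := by
  refine leftLim_eq_of_tendsto ((hF.tendsto_leftLim z).congr' ?_)
  filter_upwards [Ioo_mem_nhdsLT hz.1] with y hy
  exact h ⟨hy.1.le, hy.2.le.trans hz.2⟩

theorem rightLim_congr_of_eqOn_Icc {F v : ℝ → ℝ} (hF : Monotone F) {α β : ℝ}
    (h : EqOn F v (Icc α β)) {z : ℝ} (hz : z ∈ Ico α β) :
    Function.rightLim v z = Function.rightLim F z := by
  refine rightLim_eq_of_tendsto ((hF.tendsto_rightLim z).congr' ?_)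
  filter_upwards [Ioo_mem_nhdsGT hz.2] with y hy
  exact h ⟨hz.1.trans hy.1.le, hy.2.le⟩

theorem jumpSize_congr_of_eqOn_Icc {F v : ℝ → ℝ} (hF : Monotone F) {α β : ℝ}
    (h : EqOn F v (Icc α β)) {z : ℝ} (hz : z ∈ Ioo α β) : jumpSize v z = jumpSize F z := by
  rw [jumpSize, jumpSize, leftLim_congr_of_eqOn_Icc hF h ⟨hz.1, hz.2.le⟩,
    rightLim_congr_of_eqOn_Icc hF h ⟨hz.1.le, hz.2⟩]

theorem jumpPoints_congr_of_eqOn_Icc {F v : ℝ → ℝ} (hF : Monotone F) {α β : ℝ}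
    (h : EqOn F v (Icc α β)) : jumpPoints α β v = jumpPoints α β F := by
  ext z
  refine and_congr_right fun hz => ?_
  rw [leftLim_congr_of_eqOn_Icc hF h ⟨hz.1, hz.2.le⟩,
    rightLim_congr_of_eqOn_Icc hF h ⟨hz.1.le, hz.2⟩]

theorem mainTheorem4 (K : ℝ≥0 → ℝ≥0) (hK1 : CondK1 K) (hK2 : CondK2 K) (hK3 : CondK3 K)
    (lam : ℝ) (hlam : 0 < lam) (α β : ℝ) (hαβ : α < β)
    (g : ℝ → ℝ) (hg_cont : ContinuousOn g (Icc α β)) (hg_mono : MonotoneOn g (Icc α β))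
    (ρ : ℝ) (hρ : ρ = g β - g α)
    (M : ℝ) (hM : 0 < M) (hρM : ρ ≤ M)
    (CM : ℝ) (hCM : IsK2Const K M CM)
    (Cstar : ℝ) (hCstar : Cstar = CM - lam * (β - α) / 2) (hCstar_pos : 0 < Cstar)
    (U₀ : ℝ → ℝ) (hU₀ : IsOptimalOneJump K lam α β g U₀)
    (v : ℝ → ℝ) (hv_mono : MonotoneOn v (Icc α β))
    (hv_contα : ContinuousWithinAt v (Icc α β) α) (hv_contβ : ContinuousWithinAt v (Icc α β) β)
    (hvα : v α = g α) (hvβ : v β = g β) :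
    (∀ z ∈ jumpPoints α β v, 0 < jumpSize v z) ∧
    Summable (fun z : jumpPoints α β v => jumpSize v z) ∧
    Summable (fun z : jumpPoints α β v => jumpSize v z ^ 2) ∧
    tvKg K lam α β g U₀ + ENNReal.ofReal (Cstar / 2 * jumpTerm α β ρ v) ≤ tvKg K lam α β g v ∧
    0 ≤ jumpTerm α β ρ v ∧
    (0 < ρ → (jumpTerm α β ρ v = 0 ↔ ∃ z ∈ jumpPoints α β v, jumpSize v z = ρ)) := by
  obtain ⟨F, hF, hFv⟩ := hv_mono.exists_monotone_eqOn_Icc hαβ.le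
  obtain ⟨G, hG, hGg⟩ := hg_mono.exists_monotone_eqOn_Icc hαβ.le
  have hα : α ∈ Icc α β := left_mem_Icc.2 hαβ.le
  have hβ : β ∈ Icc α β := right_mem_Icc.2 hαβ.le
  have hFα : Function.rightLim F α = g α := by
    rw [← rightLim_congr_of_eqOn_Icc hF hFv ⟨le_rfl, hαβ⟩, ← hvα]
    exact ((continuousWithinAt_Icc_iff_Ici hαβ).1 hv_contα).rightLim_eq
  have hFβ : Function.leftLim F β = g β := by
    rw [← leftLim_congr_of_eqOn_Icc hF hFv ⟨hαβ, le_rfl⟩, ← hvβ]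
    exact ((continuousWithinAt_Icc_iff_Iic hαβ).1 hv_contβ).leftLim_eq
  have hJ := jumpPoints_congr_of_eqOn_Icc hF hFv
  have hs : ∀ z : jumpPoints α β F, jumpSize v z = jumpSize F z := fun z =>
    jumpSize_congr_of_eqOn_Icc hF hFv z.2.1
  have hT : jumpTerm α β ρ v = jumpTerm α β ρ F := by
    rw [jumpTerm, hJ]
    simp only [hs]
    rfl
  have hae : ∀ {u w : ℝ → ℝ}, EqOn u w (Icc α β) → u =ᵐ[volume.restrict (Ioo α β)] w :=
    fun h => by
      filter_upwards [ae_restrict_mem measurableSet_Ioo] with x hx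
      exact h (Ioo_subset_Icc_self hx)
  have hpos : ∀ z : jumpPoints α β F, 0 < jumpSize F z := fun z => hF.jumpSize_pos z.2
  have hSρ : ∑' z : jumpPoints α β F, jumpSize F z ≤ ρ := by
    have := hF.tsum_jumpSize_le hαβ
    rwa [hFα, hFβ, ← hρ] at this
  have hsum := hF.summable_jumpSize α β
  have hsum2 := hF.summable_jumpSize_sq α β
  rw [hT, hJ]
  simp only [hs]
  refine ⟨fun z hz => (hs ⟨z, hz⟩).symm ▸ hpos ⟨z, hz⟩, hsum, hsum2, ?_, ?_, fun hρ0 => ?_⟩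
  · rcases (hg_mono hα hβ hαβ.le).eq_or_lt with heq | hlt
    · have hT0 : Cstar / 2 * jumpTerm α β ρ F ≤ 0 := by
        have h1 := hF.jumpTerm_le hαβ (ρ := ρ) (by rw [hFα, hFβ, hρ])
        have h2 : 0 ≤ ∑' z : jumpPoints α β F, jumpSize F z ^ 2 := tsum_nonneg fun z => sq_nonneg _
        have h3 : ρ = 0 := by rw [hρ, heq, sub_self]
        rw [h3] at h1 ⊢
        exact mul_nonpos_of_nonneg_of_nonpos (by linarith) (by linarith)
      rw [ENNReal.ofReal_of_nonpos hT0, add_zero]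
      obtain ⟨γ, hγ⟩ := nonempty_Ioo.2 hαβ
      have hconst : ∀ x ∈ Icc α β, v x = g α := fun x hx =>
        le_antisymm ((hv_mono hx hβ hx.2).trans (by rw [hvβ, heq]))
          (hvα ▸ hv_mono hα hx hx.1)
      exact hU₀.2 v ⟨γ, hγ, fun x hx => hconst x ⟨hx.1, hx.2.le.trans hγ.2.le⟩,
        fun x hx => heq ▸ hconst x ⟨hγ.1.le.trans hx.1.le, hx.2⟩⟩
    · obtain ⟨γ, hγ, hle⟩ := hF.exists_stepFun_tvKg_add_le hG.measurable hK1 hK3 hCM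
        (hρ ▸ hρM) hlam hαβ hlt hFα hFβ (hCstar ▸ hCstar_pos)
      rw [← hρ, ← hCstar] at hle
      have hv : tvKg K lam α β g v = tvKg K lam α β G F := by
        rw [tvKg, tvKg, tvK_congr K (hae hFv), fidelity_congr (hae hGg) (hae hFv)]
      have hW : tvKg K lam α β g (stepFun γ (g α) (g β))
          = tvKg K lam α β G (stepFun γ (g α) (g β)) := by
        rw [tvKg, tvKg, fidelity_congr (hae hGg) (EventuallyEq.refl _ _)]
      rw [hv]
      refine le_trans ?_ hle
      gcongr
      rw [← hW]
      exact hU₀.2 _ (stepFun_isOneJump hγ g)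
  · have := tsum_sq_le_sq_tsum (fun z => (hpos z).le) hsum hsum2
    rw [jumpTerm]
    linarith [sq_nonneg (ρ - ∑' z : jumpPoints α β F, jumpSize F z)]
  · rw [jumpTerm, sq_tsum_sub_tsum_sq_add_eq_zero_iff hpos hsum hsum2 hSρ hρ0]
    exact ⟨fun ⟨z, hz⟩ => ⟨z, z.2, (hs z).trans hz⟩, fun ⟨z, hz, h⟩ => ⟨⟨z, hz⟩, (hs ⟨z, hz⟩) ▸ h⟩⟩
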